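/- All systems are finite-dimensional and non-zero. A quantum channel $\mathcal N\in\mathrm{CPTP}(A\to B)$ is a completely positive trace-preserving map. A superchannel $\Theta[\mathcal N]=\mathcal E^{RB\to B}\circ(\mathrm{id}_R\otimes\mathcal N)\circ\mathcal V^{A'\to RA}$ ($\mathcal V$ an isometry channel, $\mathcal E$ a channel) is *mixing* if, for all systems $C_0,C_1$, $\Theta\otimes\mathbb 1^{(C_0\to C_1)}$ maps every channel $\mathcal N^{AC_0\to BC_1}$ of the form $\mathcal N=\mathbf u^B\otimes \mathrm{Tr}_B\circ\mathcal N$ ($\mathbf u^B$ the uniform state) to a channel of the same form. For channels with the same output system, $\mathcal N\succ\mathcal M$ means $\mathcal M=\Theta[\mathcal N]$ for some mixing superchannel $\Theta$; for different output dimensions, the smaller output system is first embedded into the larger one by some isometry channel. A *channel entropy* is a real-valued function $\mathbb H$ on all quantum channels, not identically zero, with $\mathbb H(\mathcal N)\le\mathbb H(\mathcal M)$ whenever $\mathcal N\succ\mathcal M$, and $\mathbb H(\mathcal N\otimes\mathcal M)=\mathbb H(\mathcal N)+\mathbb H(\mathcal M)$. A classical channel $\mathcal N^{X\to Y}$ is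 given by probability vectors $\mathbf p_x$ on $Y$, $x\in X$, and is identified with the quantum channel $\rho\mapsto\sum_x\rho_{xx}\,\mathrm{diag}(\mathbf p_x)$; a probability vector is a classical channel with one-element input. Among classical channels with the same output, $\mathcal N\succ\mathcal M$ means $\mathcal M=\mathcal D\circ\mathcal N\circ\mathcal S$ with a classical channel $\mathcal S^{X'\to XZ}$ and a classical channel $\mathcal D^{YZ\to Y}$ that is doubly stochastic for each value $z$ of $Z$; outputs of different sizes are treated by padding with zeros. A *classical channel entropy* is a not identically zero real-valued function on all classical channels that is monotone (in the above sense) and additive. Let $H(\mathbf p)=-\sum_y p_y\log_2p_y$, and $$\underline H(\mathcal N)=\sup\{H(\mathbf q):\mathbf q\succ\mathcal N\},\qquad \overline H(\mathcal N)=\inf\{H(\mathbf q):\mathcal N\succ\mathbf q\},$$ where $\mathbf q$ runs over the probability vectors of arbitrary finite length. **Theorem.** For every classical channel $\mathcal N$ the two sets above are non-empty and, respectively, bounded above and below; the limit $\underline H^{\rm reg}(\mathcal N)=\lim_{k\to\infty}\frac1k\underline H(\mathcal N^{\otimes k})$ exists, and $$\underline H^{\rm reg}(\mathcal N)=\overline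 H(\mathcal N)=\min_{x}H(\mathbf p_x).$$ Every channel entropy $\mathbb H$ that reduces to the Shannon entropy $H$ on probability vectors satisfies $\mathbb H(\mathcal N)=\min_xH(\mathbf p_x)$ for every classical channel $\mathcal N$. Moreover, a function on classical channels is a classical channel entropy that reduces to $H$ on probability vectors if and only if it is $\mathcal N\mapsto\min_xH(\mathbf p_x)$; so there is exactly one such extension of the Shannon entropy to classical channels. -/

import Mathlib

open Filter Topology
open scoped Matrix ComplexOrder

noncomputable section

/-! ### Classical channels -/

/-- A classical channel `X → Y`: for every input `x` a probability vector `prob x` on `Y`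
(the column `p_x` of the transition matrix). A probability vector on `Y` is a channel
`Unit → Y`. -/
@[ext]
structure ClassicalChannel (X Y : Type) [Fintype Y] where
  prob : X → Y → ℝ
  nonneg : ∀ x y, 0 ≤ prob x y
  sum_eq_one : ∀ x, ∑ y, prob x y = 1

namespace ClassicalChannel

/-- Parallel use of two channels. -/
def tensor {X Y X' Y' : Type} [Fintype Y] [Fintype Y']
    (N : ClassicalChannel X Y) (M : ClassicalChannel X' Y') :
    ClassicalChannel (X × X') (Y × Y') where
  prob x y := N.prob x.1 y.1 * M.prob x.2 y.2
  nonneg x y := mul_nonneg (N.nonneg _ _) (M.nonneg _ _)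
  sum_eq_one x := by
    rw [Fintype.sum_prod_type, ← Fintype.sum_mul_sum, N.sum_eq_one, M.sum_eq_one, one_mul]

/-- The `k`-fold tensor power: `k` parallel uses of the channel. -/
def power {X Y : Type} [Fintype Y] (N : ClassicalChannel X Y) (k : ℕ) :
    ClassicalChannel (Fin k → X) (Fin k → Y) where
  prob x y := ∏ i, N.prob (x i) (y i)
  nonneg x y := Finset.prod_nonneg fun i _ => N.nonneg _ _
  sum_eq_one x := by
    classical
    have h := Finset.prod_univ_sum (fun _ : Fin k => (Finset.univ : Finset Y))
      (fun i y => N.prob (x i) y)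
    rw [Fintype.piFinset_univ] at h
    rw [← h]
    exact Finset.prod_eq_one fun i _ => N.sum_eq_one _

open Classical in
/-- Post-processing by an embedding `e` of the output system into a larger one (padding
the output vectors with zeros): the classical isometry channels. -/
def embed {X Y Y' : Type} [Fintype Y] [Fintype Y'] (N : ClassicalChannel X Y) (e : Y ↪ Y') :
    ClassicalChannel X Y' where
  prob x y' := ∑ y, if e y = y' then N.prob x y else 0
  nonneg x y' := Finset.sum_nonneg fun y _ => by
    split_ifs
    · exact N.nonneg _ _
    · exact le_rfl
  sum_eq_one x := by
    rw [Finset.sum_comm]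
    simp [N.sum_eq_one]

open Classical in
/-- `M` arises from `N` (same output system) by a random permutation superchannel
`M = D ∘ N ∘ S`: the input of `M` is pre-processed by a channel `S : X' → X × Z`, and the
output of `N` by the doubly stochastic matrix `D z`, conditioned on the classical message `z`. -/
def MajorizesSame {X X' Y : Type} [Fintype X] [Fintype Y]
    (N : ClassicalChannel X Y) (M : ClassicalChannel X' Y) : Prop :=
  ∃ (Z : Type) (_ : Fintype Z) (S : ClassicalChannel X' (X × Z)) (D : Z → Matrix Y Y ℝ),
    (∀ z, D z ∈ doublyStochastic ℝ Y) ∧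
    ∀ w y, M.prob w y = ∑ x, ∑ z, S.prob w (x, z) * (D z *ᵥ N.prob x) y

/-- Channel majorization `N ≻ M` for classical channels, where the smaller output system
is embedded into the larger one. -/
def Majorizes {X Y X' Y' : Type} [Fintype X] [Fintype Y] [Fintype Y']
    (N : ClassicalChannel X Y) (M : ClassicalChannel X' Y') : Prop :=
  (Fintype.card Y' < Fintype.card Y ∧ ∃ e : Y' ↪ Y, N.MajorizesSame (M.embed e)) ∨
  (Fintype.card Y ≤ Fintype.card Y' ∧ ∃ e : Y ↪ Y', (N.embed e).MajorizesSame M)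

end ClassicalChannel

/-- Shannon entropy in bits. -/
def shannonEntropy {Y : Type} [Fintype Y] (p : Y → ℝ) : ℝ :=
  -∑ y, p y * Real.logb 2 (p y)

/-- Real-valued functions on all classical channels between finite non-empty systems. -/
abbrev ClassicalChannelFunction : Type 1 :=
  ∀ (X Y : Type) [Fintype X] [Nonempty X] [Fintype Y], ClassicalChannel X Y → ℝ

/-- Channel entropies on the classical domain: non-zero, monotone under channel
majorization, additive under tensor products. -/
structure IsClassicalChannelEntropy (H : ClassicalChannelFunction) : Prop where
  nonzero : ∃ (X Y : Type) (_ : Fintype X) (_ : Nonempty X) (_ : Fintype Y)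
    (N : ClassicalChannel X Y), H X Y N ≠ 0
  monotone : ∀ (X Y X' Y' : Type) [Fintype X] [Nonempty X] [Fintype Y]
    [Fintype X'] [Nonempty X'] [Fintype Y']
    (N : ClassicalChannel X Y) (M : ClassicalChannel X' Y'),
    N.Majorizes M → H X Y N ≤ H X' Y' M
  additive : ∀ (X Y X' Y' : Type) [Fintype X] [Nonempty X] [Fintype Y]
    [Fintype X'] [Nonempty X'] [Fintype Y']
    (N : ClassicalChannel X Y) (M : ClassicalChannel X' Y'),
    H (X × X') (Y × Y') (N.tensor M) = H X Y N + H X' Y' M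

/-- `min_x H(p_x)`, as a function on classical channels. -/
def minOutputEntropy : ClassicalChannelFunction := fun X _ _ _ _ N =>
  (Finset.univ : Finset X).inf' Finset.univ_nonempty fun x => shannonEntropy (N.prob x)

/-- The values `H(q)` over probability vectors `q` of arbitrary finite length, `q ≻ N`. -/
def minExtensionSet {X Y : Type} [Fintype Y] (N : ClassicalChannel X Y) : Set ℝ :=
  {h | ∃ (n : ℕ) (q : ClassicalChannel Unit (Fin n)),
    q.Majorizes N ∧ h = shannonEntropy (q.prob ())}

/-- The values `H(q)` over probability vectors `q` of arbitrary finite length, `N ≻ q`. -/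
def maxExtensionSet {X Y : Type} [Fintype X] [Fintype Y] (N : ClassicalChannel X Y) : Set ℝ :=
  {h | ∃ (n : ℕ) (q : ClassicalChannel Unit (Fin n)),
    N.Majorizes q ∧ h = shannonEntropy (q.prob ())}

/-- The minimal extension of Shannon entropy to classical channels. -/
def minExtension {X Y : Type} [Fintype Y] (N : ClassicalChannel X Y) : ℝ :=
  sSup (minExtensionSet N)

/-- The maximal extension of Shannon entropy to classical channels. -/
def maxExtension {X Y : Type} [Fintype X] [Fintype Y] (N : ClassicalChannel X Y) : ℝ :=
  sInf (maxExtensionSet N)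

/-! ### Quantum channels -/

/-- `id_R ⊗ Φ`, acting blockwise. -/
def idTensor (R : Type) {A B : Type} (Φ : Matrix A A ℂ →ₗ[ℂ] Matrix B B ℂ) :
    Matrix (R × A) (R × A) ℂ →ₗ[ℂ] Matrix (R × B) (R × B) ℂ where
  toFun ρ := Matrix.of fun i j => Φ (Matrix.of fun a a' => ρ (i.1, a) (j.1, a')) i.2 j.2
  map_add' ρ σ := by
    ext i j
    exact congrFun (congrFun (map_add Φ (Matrix.of fun a a' => ρ (i.1, a) (j.1, a'))
      (Matrix.of fun a a' => σ (i.1, a) (j.1, a'))) i.2) j.2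
  map_smul' c ρ := by
    ext i j
    exact congrFun (congrFun (map_smul Φ c
      (Matrix.of fun a a' => ρ (i.1, a) (j.1, a'))) i.2) j.2

/-- `Φ ⊗ id_C`, acting blockwise. -/
def tensorId (C : Type) {A B : Type} (Φ : Matrix A A ℂ →ₗ[ℂ] Matrix B B ℂ) :
    Matrix (A × C) (A × C) ℂ →ₗ[ℂ] Matrix (B × C) (B × C) ℂ where
  toFun ρ := Matrix.of fun i j => Φ (Matrix.of fun a a' => ρ (a, i.2) (a', j.2)) i.1 j.1
  map_add' ρ σ := by
    ext i j
    exact congrFun (congrFun (map_add Φ (Matrix.of fun a a' => ρ (a, i.2) (a', j.2))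
      (Matrix.of fun a a' => σ (a, i.2) (a', j.2))) i.1) j.1
  map_smul' c ρ := by
    ext i j
    exact congrFun (congrFun (map_smul Φ c
      (Matrix.of fun a a' => ρ (a, i.2) (a', j.2))) i.1) j.1

/-- A quantum channel `A → B` between finite-dimensional systems (with bases indexed by
`A` and `B`): a completely positive, trace-preserving linear map. -/
structure QuantumChannel (A B : Type) [Fintype A] [Fintype B] where
  map : Matrix A A ℂ →ₗ[ℂ] Matrix B B ℂ
  completelyPositive : ∀ (R : Type) [Fintype R] (ρ : Matrix (R × A) (R × A) ℂ),
    ρ.PosSemidef → (idTensor R map ρ).PosSemidef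
  tracePreserving : ∀ ρ : Matrix A A ℂ, (map ρ).trace = ρ.trace

/-- `ρ ↦ V ρ V†`. -/
def conjMap {A B : Type} [Fintype A] (V : Matrix B A ℂ) :
    Matrix A A ℂ →ₗ[ℂ] Matrix B B ℂ where
  toFun ρ := V * ρ * Vᴴ
  map_add' ρ σ := by rw [Matrix.mul_add, Matrix.add_mul]
  map_smul' c ρ := by simp

open Classical in
/-- `V` is an isometry, so that `conjMap V` is an isometry channel. -/
def IsIsometryMatrix {A B : Type} [Fintype B] (V : Matrix B A ℂ) : Prop :=
  Vᴴ * V = 1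

namespace QuantumChannel

/-- The tensor product of two channels, `(N ⊗ id) ∘ (id ⊗ M)`. -/
def tensor {A B A' B' : Type} [Fintype A] [Fintype B] [Fintype A'] [Fintype B']
    (N : QuantumChannel A B) (M : QuantumChannel A' B') :
    QuantumChannel (A × A') (B × B') where
  map := tensorId B' N.map ∘ₗ idTensor A M.map
  completelyPositive R _ ρ hρ := by
    have h1 := (M.completelyPositive (R × A) _
      (hρ.submatrix (Equiv.prodAssoc R A A'))).submatrix
      (fun i : (R × B') × A => ((i.1.1, i.2), i.1.2))
    have h2 := (N.completelyPositive (R × B') _ h1).submatrix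
      (fun i : R × (B × B') => ((i.1, i.2.2), i.2.1))
    exact h2
  tracePreserving ρ := by
    have h1 : ∀ σ : Matrix (A × B') (A × B') ℂ, (tensorId B' N.map σ).trace = σ.trace := by
      intro σ
      simp only [Matrix.trace, Matrix.diag, Fintype.sum_prod_type_right]
      exact Finset.sum_congr rfl fun c _ =>
        N.tracePreserving (Matrix.of fun a a' => σ (a, c) (a', c))
    have h2 : (idTensor A M.map ρ).trace = ρ.trace := by
      simp only [Matrix.trace, Matrix.diag, Fintype.sum_prod_type]
      exact Finset.sum_congr rfl fun c _ =>
        M.tracePreserving (Matrix.of fun a a' => ρ (c, a) (c, a'))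
    rw [LinearMap.comp_apply, h1, h2]

end QuantumChannel

/-- A superchannel from channels `A → B` to channels `A' → B`, realized by a
pre-processing isometry `A' → R A` and a post-processing channel `R B → B`. -/
structure Superchannel (A B A' : Type) [Fintype A] [Fintype B] [Fintype A'] where
  R : Type
  [fintypeR : Fintype R]
  V : Matrix (R × A) A' ℂ
  isometry : IsIsometryMatrix V
  E : QuantumChannel (R × B) B

attribute [instance] Superchannel.fintypeR

open Classical in
/-- `N` on `A C₀ → B C₁` is marginally uniform with respect to `B`: `N = u_B ⊗ Tr_B N`. -/
def MarginallyUniform {A₀ B C₁ : Type} [Fintype B]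
    (N : Matrix A₀ A₀ ℂ →ₗ[ℂ] Matrix (B × C₁) (B × C₁) ℂ) : Prop :=
  ∀ ρ b c b' c', N ρ (b, c) (b', c') =
    if b = b' then (Fintype.card B : ℂ)⁻¹ * ∑ d, N ρ (d, c) (d, c') else 0

namespace Superchannel

variable {A B A' : Type} [Fintype A] [Fintype B] [Fintype A']

/-- `Θ[N] = E ∘ (id_R ⊗ N) ∘ V`. -/
def apply (Θ : Superchannel A B A') (N : Matrix A A ℂ →ₗ[ℂ] Matrix B B ℂ) :
    Matrix A' A' ℂ →ₗ[ℂ] Matrix B B ℂ :=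
  Θ.E.map ∘ₗ idTensor Θ.R N ∘ₗ conjMap Θ.V

/-- `(Θ ⊗ 1)[N]` for a channel `N` on `A C₀ → B C₁`, where `1` is the identity
superchannel on `C₀ → C₁`. -/
def applyExt (Θ : Superchannel A B A') {C₀ C₁ : Type}
    (N : Matrix (A × C₀) (A × C₀) ℂ →ₗ[ℂ] Matrix (B × C₁) (B × C₁) ℂ) :
    Matrix (A' × C₀) (A' × C₀) ℂ →ₗ[ℂ] Matrix (B × C₁) (B × C₁) ℂ :=
  tensorId C₁ Θ.E.map ∘ₗ
  (Matrix.reindexLinearEquiv ℂ ℂ (Equiv.prodAssoc Θ.R B C₁).symm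
    (Equiv.prodAssoc Θ.R B C₁).symm).toLinearMap ∘ₗ
  idTensor Θ.R N ∘ₗ
  (Matrix.reindexLinearEquiv ℂ ℂ (Equiv.prodAssoc Θ.R A C₀)
    (Equiv.prodAssoc Θ.R A C₀)).toLinearMap ∘ₗ
  tensorId C₀ (conjMap Θ.V)

/-- Mixing superchannels: `Θ` is completely uniformity-preserving. -/
def IsMixing (Θ : Superchannel A B A') : Prop :=
  ∀ (C₀ C₁ : Type) [Fintype C₀] [Nonempty C₀] [Fintype C₁] [Nonempty C₁]
    (N : QuantumChannel (A × C₀) (B × C₁)),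
    MarginallyUniform N.map → MarginallyUniform (Θ.applyExt N.map)

end Superchannel

/-- Majorization of quantum channels with the same output system. -/
def QuantumMajorizesSame {A A' B : Type} [Fintype A] [Fintype A'] [Fintype B]
    (N : Matrix A A ℂ →ₗ[ℂ] Matrix B B ℂ) (M : Matrix A' A' ℂ →ₗ[ℂ] Matrix B B ℂ) : Prop :=
  ∃ Θ : Superchannel A B A', Θ.IsMixing ∧ M = Θ.apply N

/-- Channel majorization `N ≻ M` for quantum channels, where the smaller output system is
embedded into the larger one by an isometry channel. -/
def QuantumChannel.Majorizes {A B A' B' : Type} [Fintype A] [Fintype B]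
    [Fintype A'] [Fintype B'] (N : QuantumChannel A B) (M : QuantumChannel A' B') : Prop :=
  (Fintype.card B' < Fintype.card B ∧ ∃ U : Matrix B B' ℂ, IsIsometryMatrix U ∧
    QuantumMajorizesSame N.map (conjMap U ∘ₗ M.map)) ∨
  (Fintype.card B ≤ Fintype.card B' ∧ ∃ U : Matrix B' B ℂ, IsIsometryMatrix U ∧
    QuantumMajorizesSame (conjMap U ∘ₗ N.map) M.map)

/-- Real-valued functions on all quantum channels between finite-dimensional non-zero
systems. -/
abbrev QuantumChannelFunction : Type 1 :=
  ∀ (A B : Type) [Fintype A] [Nonempty A] [Fintype B], QuantumChannel A B → ℝ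

/-- Channel entropies: non-zero, monotone under channel majorization, additive under
tensor products. -/
structure IsChannelEntropy (H : QuantumChannelFunction) : Prop where
  nonzero : ∃ (A B : Type) (_ : Fintype A) (_ : Nonempty A) (_ : Fintype B)
    (N : QuantumChannel A B), H A B N ≠ 0
  monotone : ∀ (A B A' B' : Type) [Fintype A] [Nonempty A] [Fintype B]
    [Fintype A'] [Nonempty A'] [Fintype B']
    (N : QuantumChannel A B) (M : QuantumChannel A' B'),
    N.Majorizes M → H A B N ≤ H A' B' M
  additive : ∀ (A B A' B' : Type) [Fintype A] [Nonempty A] [Fintype B]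
    [Fintype A'] [Nonempty A'] [Fintype B']
    (N : QuantumChannel A B) (M : QuantumChannel A' B'),
    H (A × A') (B × B') (N.tensor M) = H A B N + H A' B' M

open Classical in
/-- The linear map `ρ ↦ ∑ x, ρ x x • diag(p_x)`. -/
def ClassicalChannel.toLinearMap {X Y : Type} [Fintype X] [Fintype Y]
    (N : ClassicalChannel X Y) : Matrix X X ℂ →ₗ[ℂ] Matrix Y Y ℂ where
  toFun ρ := Matrix.diagonal fun y => ∑ x, ρ x x * (N.prob x y : ℂ)
  map_add' ρ σ := by
    rw [Matrix.diagonal_add]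
    simp only [Matrix.add_apply, add_mul, Finset.sum_add_distrib]
  map_smul' c ρ := by
    rw [← Matrix.diagonal_smul]
    congr 1
    funext y
    simp only [Matrix.smul_apply, smul_eq_mul, mul_assoc, RingHom.id_apply, Pi.smul_apply,
      Finset.mul_sum]

open Classical in
/-- A classical channel as a quantum channel, `ρ ↦ ∑ x, ρ x x • diag(p_x)`; in particular
a probability vector as a diagonal density matrix. -/
def ClassicalChannel.toQuantum {X Y : Type} [Fintype X] [Fintype Y]
    (N : ClassicalChannel X Y) : QuantumChannel X Y where
  map := N.toLinearMap
  completelyPositive R _ ρ hρ := by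
    have key : idTensor R N.toLinearMap ρ = ∑ y₀ : Y, ∑ x : X,
        (N.prob x y₀ : ℂ) • ((Matrix.diagonal fun i : R × Y => if i.2 = y₀ then (1 : ℂ) else 0)ᴴ
          * ρ.submatrix (fun i : R × Y => (i.1, x)) (fun i : R × Y => (i.1, x))
          * (Matrix.diagonal fun i : R × Y => if i.2 = y₀ then (1 : ℂ) else 0)) := by
      ext i j
      simp only [Matrix.sum_apply, Matrix.smul_apply, Matrix.diagonal_conjTranspose,
        Matrix.mul_diagonal, Matrix.diagonal_mul, idTensor, toLinearMap, LinearMap.coe_mk, AddHom.coe_mk,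
        Matrix.of_apply, Matrix.submatrix_apply, Matrix.diagonal_apply, smul_eq_mul]
      rw [Finset.sum_eq_single i.2]
      · by_cases h : i.2 = j.2
        · simp [h, mul_comm]
        · simp [h, Ne.symm h]
      · intro y _ hy
        simp [hy.symm]
      · simp
    rw [key]
    refine Matrix.posSemidef_sum _ fun y₀ _ => Matrix.posSemidef_sum _ fun x _ => ?_
    exact ((hρ.submatrix _).conjTranspose_mul_mul_same _).smul
      (by exact_mod_cast N.nonneg x y₀)
  tracePreserving ρ := by
    simp only [toLinearMap, LinearMap.coe_mk, AddHom.coe_mk, Matrix.trace_diagonal]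
    rw [Finset.sum_comm]
    refine Finset.sum_congr rfl fun x _ => ?_
    rw [← Finset.mul_sum]
    have := N.sum_eq_one x
    rw [← Complex.ofReal_sum, this]
    simp [Matrix.diag]

end

/-!
Entropy is concave and doubly stochastic matrices are mixtures of permutations, so a channel only
majorizes channels all of whose outputs have entropy at least `min_x H(p_x)`. Since `N ≻ p_x` for
each `x`, this bounds every extension of the Shannon entropy from above.

For the bound from below let `0 < c < min_x H(p_x)`. By Chernoff's bound, every output of `N^{⊗k}`
has mass at most `δ` on the outcomes that are more likely than about `2^{-kc}`, for all large `k`.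
One vector with an entry `δ` and about `2^{kc}` further equal entries therefore majorizes all the
outputs simultaneously, hence majorizes `N^{⊗k}`: each output splits into a part of weight `δ` and a
part so flat that the equal entries can be spread over it. Its entropy is about `(1 - δ) k c`, and
by additivity of the entropy dividing by `k` gives the bound.

Finally, a classical pre-processing is implemented by an isometry that leaves a copy of its input in
the reference system, and message-controlled doubly stochastic post-processing is mixing. Hence a
channel entropy restricts to a classical channel entropy.
-/

theorem shannonEntropy_eq_sum_negMulLog {Y : Type} [Fintype Y] (p : Y → ℝ) :
    shannonEntropy p = (∑ y, Real.negMulLog (p y)) / Real.log 2 := by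
  simp only [shannonEntropy, Real.negMulLog, Real.logb, neg_mul, Finset.sum_neg_distrib, neg_div,
    Finset.sum_div, mul_div_assoc]

theorem shannonEntropy_comp_equiv {Y Y' : Type} [Fintype Y] [Fintype Y'] (e : Y ≃ Y')
    (p : Y' → ℝ) : shannonEntropy (p ∘ e) = shannonEntropy p :=
  congrArg Neg.neg (e.sum_comp fun y => p y * Real.logb 2 (p y))

theorem shannonEntropy_extend {Y Y' : Type} [Fintype Y] [Fintype Y'] (e : Y ↪ Y') (p : Y → ℝ) :
    shannonEntropy (Function.extend e p 0) = shannonEntropy p := by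
  refine congrArg Neg.neg (Fintype.sum_of_injective e e.injective _ _ (fun y hy => ?_)
    fun y => ?_).symm
  · rw [Function.extend_apply' _ _ _ hy, Pi.zero_apply, zero_mul]
  · rw [e.injective.extend_apply]

theorem concaveOn_shannonEntropy {Y : Type} [Fintype Y] :
    ConcaveOn ℝ (Set.Ici (0 : Y → ℝ)) shannonEntropy := by
  refine ⟨convex_Ici 0, fun p hp q hq a b ha hb hab => ?_⟩
  simp only [shannonEntropy_eq_sum_negMulLog, smul_eq_mul, ← mul_div_assoc, ← add_div,
    Finset.mul_sum, ← Finset.sum_add_distrib]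
  gcongr with y
  exact Real.concaveOn_negMulLog.2 (hp y) (hq y) ha hb hab

theorem exists_mulVec_eq_sum_perm {Y : Type} [Fintype Y] [DecidableEq Y] {D : Matrix Y Y ℝ}
    (hD : D ∈ doublyStochastic ℝ Y) :
    ∃ w ∈ stdSimplex ℝ (Equiv.Perm Y), ∀ p, D *ᵥ p = ∑ σ, w σ • (p ∘ σ) := by
  obtain ⟨w, hw₀, hw₁, rfl⟩ := exists_eq_sum_perm_of_mem_doublyStochastic hD
  refine ⟨w, ⟨hw₀, hw₁⟩, fun p => ?_⟩
  simp only [Matrix.sum_mulVec, Matrix.smul_mulVec, Matrix.permMatrix_mulVec]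

theorem mulVec_mem_of_convex {Y : Type} [Fintype Y] [DecidableEq Y] {D : Matrix Y Y ℝ}
    (hD : D ∈ doublyStochastic ℝ Y) {C : Set (Y → ℝ)} (hC : Convex ℝ C) {p : Y → ℝ}
    (hp : ∀ σ : Equiv.Perm Y, p ∘ σ ∈ C) : D *ᵥ p ∈ C := by
  obtain ⟨w, ⟨hw₀, hw₁⟩, hw⟩ := exists_mulVec_eq_sum_perm hD
  rw [hw]
  exact hC.sum_mem (fun σ _ => hw₀ σ) hw₁ fun σ _ => hp σ

theorem sum_extend_const {Y Y' : Type} [Fintype Y] [Fintype Y'] (e : Y ↪ Y') (f : Y → ℝ) (c : ℝ) :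
    ∑ y, Function.extend e f (fun _ => c) y =
      ∑ x, f x + ((Fintype.card Y' : ℝ) - Fintype.card Y) * c := by
  have h : ∑ x, (f x - c) = ∑ y, (Function.extend e f (fun _ => c) y - c) :=
    Fintype.sum_of_injective e e.injective _ _
      (fun y hy => by rw [Function.extend_apply' _ _ _ hy, sub_self])
      fun x => by rw [e.injective.extend_apply]
  simp only [Finset.sum_sub_distrib, Finset.sum_const, Finset.card_univ, nsmul_eq_mul] at h
  linarith

namespace ClassicalChannel

variable {X Y X' Y' : Type} [Fintype Y] [Fintype Y']

theorem prob_mem_stdSimplex (N : ClassicalChannel X Y) (x : X) : N.prob x ∈ stdSimplex ℝ Y :=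
  ⟨N.nonneg x, N.sum_eq_one x⟩

theorem embed_prob (N : ClassicalChannel X Y) (e : Y ↪ Y') (x : X) :
    (N.embed e).prob x = Function.extend e (N.prob x) 0 := by
  ext y'
  by_cases hy' : ∃ y, e y = y'
  · obtain ⟨y, rfl⟩ := hy'
    rw [e.injective.extend_apply]
    exact (Fintype.sum_eq_single y fun z hz => if_neg (e.injective.ne hz)).trans (if_pos rfl)
  · rw [Function.extend_apply' _ _ _ hy']
    exact Finset.sum_eq_zero fun y _ => if_neg fun h => hy' ⟨y, h⟩

theorem shannonEntropy_tensor (N : ClassicalChannel X Y) (M : ClassicalChannel X' Y')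
    (x : X × X') : shannonEntropy ((N.tensor M).prob x) =
      shannonEntropy (N.prob x.1) + shannonEntropy (M.prob x.2) := by
  simp only [shannonEntropy_eq_sum_negMulLog, ← add_div, tensor, Fintype.sum_prod_type,
    Real.negMulLog_mul, Finset.sum_add_distrib, ← Finset.sum_mul, ← Finset.mul_sum, N.sum_eq_one,
    M.sum_eq_one, one_mul]

theorem MajorizesSame.prob_mem_of_convex [Fintype X] {N : ClassicalChannel X Y}
    {M : ClassicalChannel X' Y} (h : N.MajorizesSame M) {C : Set (Y → ℝ)} (hC : Convex ℝ C)
    (hN : ∀ x (σ : Equiv.Perm Y), N.prob x ∘ σ ∈ C) (w : X') : M.prob w ∈ C := by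
  classical
  obtain ⟨Z, _, S, D, hD, hM⟩ := h
  have hMw : M.prob w = ∑ i : X × Z, S.prob w i • (D i.2 *ᵥ N.prob i.1) := by
    ext y
    simp only [hM, Fintype.sum_prod_type, Finset.sum_apply, Pi.smul_apply, smul_eq_mul]
  rw [hMw]
  exact hC.sum_mem (fun i _ => S.nonneg w i) (S.sum_eq_one w)
    fun i _ => mulVec_mem_of_convex (hD i.2) hC (hN i.1)

section minOutputEntropy

variable [Fintype X] [Nonempty X]

theorem minOutputEntropy_le (N : ClassicalChannel X Y) (x : X) :
    minOutputEntropy X Y N ≤ shannonEntropy (N.prob x) :=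
  Finset.inf'_le _ (Finset.mem_univ x)

theorem exists_minOutputEntropy_eq (N : ClassicalChannel X Y) :
    ∃ x, minOutputEntropy X Y N = shannonEntropy (N.prob x) := by
  obtain ⟨x, -, h⟩ := Finset.exists_mem_eq_inf' (Finset.univ_nonempty (α := X))
    fun x => shannonEntropy (N.prob x)
  exact ⟨x, h⟩

theorem minOutputEntropy_unit (p : ClassicalChannel Unit Y) :
    minOutputEntropy Unit Y p = shannonEntropy (p.prob ()) :=
  Finset.inf'_singleton _

theorem minOutputEntropy_embed (N : ClassicalChannel X Y) (e : Y ↪ Y') :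
    minOutputEntropy X Y' (N.embed e) = minOutputEntropy X Y N := by
  simp only [minOutputEntropy, embed_prob, shannonEntropy_extend]

theorem MajorizesSame.minOutputEntropy_le {N : ClassicalChannel X Y} {M : ClassicalChannel X' Y}
    (h : N.MajorizesSame M) (w : X') : minOutputEntropy X Y N ≤ shannonEntropy (M.prob w) := by
  refine (h.prob_mem_of_convex (concaveOn_shannonEntropy.convex_ge _) (fun x σ => ⟨?_, ?_⟩) w).2
  · exact fun y => N.nonneg x (σ y)
  · rw [shannonEntropy_comp_equiv]
    exact N.minOutputEntropy_le x

theorem Majorizes.minOutputEntropy_le {N : ClassicalChannel X Y} {M : ClassicalChannel X' Y'}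
    (h : N.Majorizes M) (w : X') : minOutputEntropy X Y N ≤ shannonEntropy (M.prob w) := by
  obtain ⟨-, e, h⟩ | ⟨-, e, h⟩ := h
  · rw [← shannonEntropy_extend e, ← embed_prob]
    exact h.minOutputEntropy_le w
  · rw [← minOutputEntropy_embed N e]
    exact h.minOutputEntropy_le w

theorem minOutputEntropy_tensor [Fintype X'] [Nonempty X'] (N : ClassicalChannel X Y)
    (M : ClassicalChannel X' Y') : minOutputEntropy (X × X') (Y × Y') (N.tensor M) =
      minOutputEntropy X Y N + minOutputEntropy X' Y' M := by
  apply le_antisymm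
  · obtain ⟨x, hx⟩ := N.exists_minOutputEntropy_eq
    obtain ⟨x', hx'⟩ := M.exists_minOutputEntropy_eq
    rw [hx, hx', ← shannonEntropy_tensor N M (x, x')]
    exact minOutputEntropy_le _ _
  · obtain ⟨x, hx⟩ := (N.tensor M).exists_minOutputEntropy_eq
    rw [hx, shannonEntropy_tensor]
    exact add_le_add (N.minOutputEntropy_le _) (M.minOutputEntropy_le _)

end minOutputEntropy

/-- A classical channel that maps the all-ones vector below the all-ones vector. Written as a
matrix with the vectors `prob x` as columns, it can be completed by further columns to a doubly
stochastic matrix. -/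
def IsSubunital [Fintype X] (T : ClassicalChannel X Y) : Prop :=
  ∀ y, ∑ x, T.prob x y ≤ 1

section IsSubunital

variable [Fintype X] {T : ClassicalChannel X Y}

theorem sum_one_sub_sum_prob (T : ClassicalChannel X Y) :
    ∑ y, (1 - ∑ x, T.prob x y) = (Fintype.card Y : ℝ) - Fintype.card X := by
  rw [Finset.sum_sub_distrib, Finset.sum_comm]
  simp [T.sum_eq_one]

theorem IsSubunital.card_le (hT : T.IsSubunital) : Fintype.card X ≤ Fintype.card Y := by
  have h := T.sum_one_sub_sum_prob ▸ Finset.sum_nonneg fun y _ => sub_nonneg.2 (hT y)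
  exact_mod_cast sub_nonneg.1 h

theorem IsSubunital.exists_doublyStochastic [DecidableEq Y] (hT : T.IsSubunital) (e : X ↪ Y) :
    ∃ D ∈ doublyStochastic ℝ Y, ∀ y x, D y (e x) = T.prob x y := by
  set r : ℝ := (Fintype.card Y : ℝ) - Fintype.card X with hr
  have hr₀ : 0 ≤ r := sub_nonneg.2 (Nat.cast_le.2 hT.card_le)
  have hs₀ : ∀ y, 0 ≤ 1 - ∑ x, T.prob x y := fun y => sub_nonneg.2 (hT y)
  have hs : ∀ y, r * ((1 - ∑ x, T.prob x y) / r) = 1 - ∑ x, T.prob x y := fun y =>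
    mul_div_cancel_of_imp' fun h => (Finset.sum_eq_zero_iff_of_nonneg fun y _ => hs₀ y).1
      (T.sum_one_sub_sum_prob.trans h) y (Finset.mem_univ y)
  -- The missing `r` columns share equally what the row sums lack to `1`; for `r = 0` that is `0`.
  refine ⟨Matrix.of fun y => Function.extend e (fun x => T.prob x y)
    fun _ => (1 - ∑ x, T.prob x y) / r, mem_doublyStochastic_iff_sum.2 ⟨fun y y' => ?_, fun y => ?_,
    fun y' => ?_⟩, fun y x => by simp [e.injective.extend_apply]⟩
  · by_cases hy' : ∃ x, e x = y'
    · obtain ⟨x, rfl⟩ := hy'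
      simpa [e.injective.extend_apply] using T.nonneg x y
    · simpa [Function.extend_apply' _ _ _ hy'] using div_nonneg (hs₀ y) hr₀
  · simp only [Matrix.of_apply, sum_extend_const, ← hr, hs]
    ring
  · by_cases hy' : ∃ x, e x = y'
    · obtain ⟨x, rfl⟩ := hy'
      simpa [e.injective.extend_apply] using T.sum_eq_one x
    · have hr_ne : r ≠ 0 := sub_ne_zero.2
        (Nat.cast_lt.2 (Fintype.card_lt_of_injective_of_notMem e e.injective hy')).ne'
      simp only [Matrix.of_apply, Function.extend_apply' _ _ _ hy', ← Finset.sum_div]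
      rw [T.sum_one_sub_sum_prob, div_self hr_ne]

end IsSubunital

theorem majorizesSame_of_doublyStochastic {q : ClassicalChannel Unit Y} {N : ClassicalChannel X Y}
    [DecidableEq Y] {D : X → Matrix Y Y ℝ} (hD : ∀ x, D x ∈ doublyStochastic ℝ Y)
    (h : ∀ x, N.prob x = D x *ᵥ q.prob ()) : q.MajorizesSame N := by
  -- The message is a permutation, drawn from the Birkhoff decomposition of `D x`.
  choose w hw hDw using fun x => exists_mulVec_eq_sum_perm (hD x)
  refine ⟨Equiv.Perm Y, inferInstance, ⟨fun x i => w x i.2, fun x i => (hw x).1 i.2, fun x => ?_⟩,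
    fun σ => σ.permMatrix ℝ, fun σ => ?_, fun x y => ?_⟩
  · simpa [Fintype.sum_prod_type] using (hw x).2
  · convert permMatrix_mem_doublyStochastic (R := ℝ) (σ := σ)
  · simp [h, hDw, Matrix.permMatrix_mulVec]

theorem majorizes_of_isSubunital {ι : Type} [Fintype ι] [Nonempty X] {q : ClassicalChannel Unit ι}
    {N : ClassicalChannel X Y} {T : X → ClassicalChannel ι Y} (hT : ∀ x, (T x).IsSubunital)
    (hN : ∀ x y, N.prob x y = ∑ i, q.prob () i * (T x).prob i y) : q.Majorizes N := by
  classical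
  have hcard : Fintype.card ι ≤ Fintype.card Y := (hT (Classical.arbitrary X)).card_le
  obtain ⟨e⟩ := Function.Embedding.nonempty_of_card_le hcard
  choose D hD hDT using fun x => (hT x).exists_doublyStochastic e
  refine Or.inr ⟨hcard, e, majorizesSame_of_doublyStochastic hD fun x => ?_⟩
  ext y
  rw [hN, embed_prob]
  refine Fintype.sum_of_injective e e.injective _ _ (fun y' hy' => ?_) fun i => ?_
  · rw [Function.extend_apply' _ _ _ hy', Pi.zero_apply, mul_zero]
  · simp only [e.injective.extend_apply, hDT, mul_comm]

theorem majorizes_of_equiv [Fintype X] {N : ClassicalChannel X Y} {M : ClassicalChannel X' Y'}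
    (f : X' → X) (e : Y ≃ Y') (h : ∀ w y, M.prob w (e y) = N.prob (f w) y) :
    N.Majorizes M := by
  classical
  refine Or.inr ⟨(Fintype.card_congr e).le, e.toEmbedding, Unit, inferInstance,
    ⟨fun w i => if i.1 = f w then 1 else 0, fun w i => by split_ifs <;> simp, fun w => ?_⟩,
    fun _ => 1, fun _ => one_mem _, fun w y' => ?_⟩
  · simp only [Fintype.sum_prod_type, Finset.univ_unique, Finset.sum_singleton,
      Finset.sum_ite_eq', Finset.mem_univ, if_true]
  · obtain ⟨y, rfl⟩ := e.surjective y'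
    simp [embed_prob, h, e.injective.extend_apply]

end ClassicalChannel

open ClassicalChannel

theorem exists_shannonEntropy_ne_zero :
    ∃ p : ClassicalChannel Unit Bool, shannonEntropy (p.prob ()) ≠ 0 := by
  refine ⟨⟨fun _ _ => 1 / 2, fun _ _ => by norm_num, fun _ => by norm_num⟩, ?_⟩
  have hlog : Real.log 2 ≠ 0 := (Real.log_pos one_lt_two).ne'
  simp [shannonEntropy, Real.logb, hlog]

theorem isClassicalChannelEntropy_minOutputEntropy :
    IsClassicalChannelEntropy minOutputEntropy where
  nonzero := by
    obtain ⟨p, hp⟩ := exists_shannonEntropy_ne_zero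
    exact ⟨Unit, Bool, inferInstance, inferInstance, inferInstance, p,
      by rwa [minOutputEntropy_unit]⟩
  monotone X Y X' Y' _ _ _ _ _ _ N M h := by
    obtain ⟨w, hw⟩ := M.exists_minOutputEntropy_eq
    rw [hw]
    exact h.minOutputEntropy_le w
  additive X Y X' Y' _ _ _ _ _ _ N M := minOutputEntropy_tensor N M

namespace IsClassicalChannelEntropy

variable {H : ClassicalChannelFunction} {X Y X' Y' : Type} [Fintype X] [Nonempty X] [Fintype Y]
  [Fintype X'] [Nonempty X'] [Fintype Y']

theorem congr_equiv (hH : IsClassicalChannelEntropy H) {N : ClassicalChannel X Y}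
    {M : ClassicalChannel X' Y'} (f : X ≃ X') (e : Y ≃ Y')
    (h : ∀ x y, M.prob (f x) (e y) = N.prob x y) : H X Y N = H X' Y' M := by
  apply le_antisymm
  · refine hH.monotone _ _ _ _ _ _ (majorizes_of_equiv f.symm e fun w y => ?_)
    rw [← h, f.apply_symm_apply]
  · refine hH.monotone _ _ _ _ _ _ (majorizes_of_equiv f e.symm fun w y => ?_)
    rw [← h, e.apply_symm_apply]

theorem power (hH : IsClassicalChannelEntropy H) (N : ClassicalChannel X Y) (k : ℕ) :
    H (Fin k → X) (Fin k → Y) (N.power k) = k * H X Y N := by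
  induction k with
  | zero =>
    have h : H _ _ (N.power 0) = H _ _ ((N.power 0).tensor (N.power 0)) :=
      hH.congr_equiv (Equiv.prodUnique _ _).symm (Equiv.prodUnique _ _).symm fun x y => by
        simp [ClassicalChannel.tensor, ClassicalChannel.power]
    rw [hH.additive] at h
    simpa using h
  | succ k ih =>
    have h : H _ _ (N.tensor (N.power k)) = H _ _ (N.power (k + 1)) :=
      hH.congr_equiv (Fin.consEquiv fun _ => X) (Fin.consEquiv fun _ => Y) fun x y => by
        simp [ClassicalChannel.tensor, ClassicalChannel.power, Fin.prod_univ_succ,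
          Fin.consEquiv]
    rw [← h, hH.additive, ih]
    push_cast
    ring

end IsClassicalChannelEntropy

section Extensions

variable {X Y : Type} [Fintype Y]

theorem shannonEntropy_mem_upperBounds_minExtensionSet (N : ClassicalChannel X Y) (x : X) :
    shannonEntropy (N.prob x) ∈ upperBounds (minExtensionSet N) := by
  rintro h ⟨n, q, hq, rfl⟩
  exact (minOutputEntropy_unit q).symm.trans_le (hq.minOutputEntropy_le x)

theorem zero_mem_minExtensionSet [Nonempty X] (N : ClassicalChannel X Y) :
    0 ∈ minExtensionSet N := by
  refine ⟨1, ⟨fun _ _ => 1, by simp, by simp⟩, majorizes_of_isSubunital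
    (T := fun x => ⟨fun _ => N.prob x, fun _ => N.nonneg x, fun _ => N.sum_eq_one x⟩)
    (fun x y => ?_) (by simp), by simp [shannonEntropy]⟩
  simpa using (N.prob_mem_stdSimplex x |> mem_Icc_of_mem_stdSimplex) y |>.2

theorem isLUB_minExtension [Nonempty X] (N : ClassicalChannel X Y) :
    IsLUB (minExtensionSet N) (minExtension N) :=
  isLUB_csSup ⟨0, zero_mem_minExtensionSet N⟩
    ⟨_, shannonEntropy_mem_upperBounds_minExtensionSet N (Classical.arbitrary X)⟩

theorem minExtension_nonneg [Nonempty X] (N : ClassicalChannel X Y) : 0 ≤ minExtension N :=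
  (isLUB_minExtension N).1 (zero_mem_minExtensionSet N)

variable [Fintype X]

theorem shannonEntropy_mem_maxExtensionSet (N : ClassicalChannel X Y) (x : X) :
    shannonEntropy (N.prob x) ∈ maxExtensionSet N := by
  let e := Fintype.equivFin Y
  refine ⟨Fintype.card Y, ⟨fun _ => N.prob x ∘ e.symm, fun _ _ => N.nonneg _ _, fun _ => ?_⟩,
    majorizes_of_equiv (fun _ => x) e (by simp), (shannonEntropy_comp_equiv e.symm _).symm⟩
  exact (e.symm.sum_comp _).trans (N.sum_eq_one x)

theorem isLeast_maxExtensionSet [Nonempty X] (N : ClassicalChannel X Y) :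
    IsLeast (maxExtensionSet N) (minOutputEntropy X Y N) := by
  constructor
  · obtain ⟨x, hx⟩ := N.exists_minOutputEntropy_eq
    rw [hx]
    exact shannonEntropy_mem_maxExtensionSet N x
  · rintro h ⟨n, q, hq, rfl⟩
    exact hq.minOutputEntropy_le ()

theorem maxExtension_eq_minOutputEntropy [Nonempty X] (N : ClassicalChannel X Y) :
    maxExtension N = minOutputEntropy X Y N :=
  (isLeast_maxExtensionSet N).csInf_eq

end Extensions

section Flattening

open Classical in
/-- The total mass of the entries of `p` that exceed the threshold `t`, for a probability vector
`p` the probability that an outcome `y` drawn from `p` has `p y > t`. -/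
noncomputable def tailMass {Y : Type} [Fintype Y] (p : Y → ℝ) (t : ℝ) : ℝ :=
  ∑ y with t < p y, p y

/-- The probability vector with first entry `δ` whose other `M` entries are equal. -/
noncomputable def spikedUniform (M : ℕ) (hM : 0 < M) (δ : ℝ) (h₀ : 0 ≤ δ) (h₁ : δ ≤ 1) :
    ClassicalChannel Unit (Fin (M + 1)) where
  prob _ := Fin.cons δ fun _ => (1 - δ) / M
  nonneg _ y := by
    refine Fin.cases h₀ (fun _ => ?_) y
    exact div_nonneg (sub_nonneg.2 h₁) M.cast_nonneg
  sum_eq_one _ := by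
    have hM' : (M : ℝ) ≠ 0 := by positivity
    simp [Fin.sum_univ_succ, mul_div_cancel₀ _ hM']

theorem mul_logb_le_shannonEntropy_spikedUniform {M : ℕ} (hM : 0 < M) {δ : ℝ} (h₀ : 0 ≤ δ)
    (h₁ : δ ≤ 1) : (1 - δ) * Real.logb 2 M ≤
      shannonEntropy ((spikedUniform M hM δ h₀ h₁).prob ()) := by
  have hM' : (M : ℝ) ≠ 0 := by positivity
  have hsum : ∑ i, Real.negMulLog ((spikedUniform M hM δ h₀ h₁).prob () i) =
      Real.negMulLog δ + Real.negMulLog (1 - δ) + (1 - δ) * Real.log M := by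
    simp only [spikedUniform, Fin.sum_univ_succ, Fin.cons_zero, Fin.cons_succ, Finset.sum_const,
      Finset.card_univ, Fintype.card_fin, nsmul_eq_mul, div_eq_mul_inv, Real.negMulLog_mul]
    simp only [Real.negMulLog, Real.log_inv]
    field_simp
    ring
  rw [shannonEntropy_eq_sum_negMulLog, Real.logb, ← mul_div_assoc, hsum]
  have hδ := Real.negMulLog_nonneg h₀ h₁
  have hδ' := Real.negMulLog_nonneg (sub_nonneg.2 h₁) (sub_le_self 1 h₀)
  gcongr
  linarith

theorem tailMass_nonneg {Y : Type} [Fintype Y] {p : Y → ℝ} (hp : 0 ≤ p) (t : ℝ) :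
    0 ≤ tailMass p t :=
  Finset.sum_nonneg fun y _ => hp y

-- The vector `b` is `p` conditioned on the outcomes `y` with `p y ≤ t`.
theorem exists_mem_stdSimplex_of_tailMass_lt_one {Y : Type} [Fintype Y] {p : Y → ℝ}
    (hp : p ∈ stdSimplex ℝ Y) {t : ℝ} (htail : tailMass p t < 1) :
    ∃ b ∈ stdSimplex ℝ Y, ∀ y, (t < p y → b y = 0) ∧
      (p y ≤ t → (1 - tailMass p t) * b y = p y) := by
  classical
  have hpos : 0 < 1 - tailMass p t := sub_pos.2 htail
  have hsum : ∑ y, (if t < p y then 0 else p y) = 1 - tailMass p t := by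
    rw [tailMass, Finset.sum_filter, ← hp.2, ← Finset.sum_sub_distrib]
    refine Finset.sum_congr rfl fun y _ => ?_
    split_ifs <;> simp
  refine ⟨fun y => (if t < p y then 0 else p y) / (1 - tailMass p t),
    ⟨fun y => div_nonneg (ite_nonneg le_rfl (hp.1 y)) hpos.le, ?_⟩, fun y => ⟨fun hy => ?_,
      fun hy => ?_⟩⟩
  · rw [← Finset.sum_div, hsum, div_self hpos.ne']
  · simp only [if_pos hy, zero_div]
  · simp only [if_neg hy.not_gt, mul_div_cancel₀ _ hpos.ne']

theorem exists_eq_add_of_tailMass_le {Y : Type} [Fintype Y] {p : Y → ℝ} (hp : p ∈ stdSimplex ℝ Y)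
    {δ : ℝ} (h₀ : 0 < δ) (h₁ : δ < 1) {m t : ℝ} (hm : 0 ≤ m) (ht : (m + 1) * t ≤ 1 - δ)
    (htail : tailMass p t ≤ δ) :
    ∃ a ∈ stdSimplex ℝ Y, ∃ b ∈ stdSimplex ℝ Y, (∀ y, p y = δ * a y + (1 - δ) * b y) ∧
      ∀ y, a y + m * b y ≤ 1 := by
  obtain ⟨b, hb, hpb⟩ := exists_mem_stdSimplex_of_tailMass_lt_one hp (htail.trans_lt h₁)
  have hμ := tailMass_nonneg hp.1 t
  have hsplit : ∀ y, p y = δ * ((p y - (1 - δ) * b y) / δ) + (1 - δ) * b y := fun y => by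
    rw [mul_div_cancel₀ _ h₀.ne', sub_add_cancel]
  have ha : (fun y => (p y - (1 - δ) * b y) / δ) ∈ stdSimplex ℝ Y := by
    refine ⟨fun y => div_nonneg ?_ h₀.le, ?_⟩
    · obtain hy | hy := lt_or_ge t (p y)
      · simpa [(hpb y).1 hy] using hp.1 y
      · rw [← (hpb y).2 hy, ← sub_mul]
        exact mul_nonneg (by linarith) (hb.1 y)
    · rw [← Finset.sum_div, Finset.sum_sub_distrib, ← Finset.mul_sum, hp.2, hb.2, mul_one,
        sub_sub_cancel, div_self h₀.ne']
  refine ⟨_, ha, b, hb, hsplit, fun y => ?_⟩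
  obtain hy | hy := lt_or_ge t (p y)
  · simpa [(hpb y).1 hy] using (mem_Icc_of_mem_stdSimplex ha y).2
  · have hab : (p y - (1 - δ) * b y) / δ ≤ b y := by
      rw [div_le_iff₀ h₀, ← (hpb y).2 hy]
      nlinarith [mul_nonneg hμ (hb.1 y)]
    have hb_le : (m + 1) * b y ≤ 1 := by
      refine le_of_mul_le_mul_left ?_ (sub_pos.2 h₁)
      calc (1 - δ) * ((m + 1) * b y) = (m + 1) * ((1 - δ) * b y) := by ring
        _ ≤ (m + 1) * ((1 - tailMass p t) * b y) := by
          gcongr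
          exact hb.1 y
        _ ≤ (m + 1) * t := by
          rw [(hpb y).2 hy]
          gcongr
        _ ≤ (1 - δ) * 1 := by rwa [mul_one]
    linarith

theorem spikedUniform_majorizes {X Y : Type} [Nonempty X] [Fintype Y] {N : ClassicalChannel X Y}
    {M : ℕ} (hM : 0 < M) {δ : ℝ} (h₀ : 0 < δ) (h₁ : δ < 1) {t : ℝ}
    (ht : ((M : ℝ) + 1) * t ≤ 1 - δ) (htail : ∀ x, tailMass (N.prob x) t ≤ δ) :
    (spikedUniform M hM δ h₀.le h₁.le).Majorizes N := by
  have hM' : (M : ℝ) ≠ 0 := by positivity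
  choose a ha b hb hN hab using fun x => exists_eq_add_of_tailMass_le (N.prob_mem_stdSimplex x)
    h₀ h₁ M.cast_nonneg ht (htail x)
  have hcons : ∀ x, ∀ i, (Fin.cons (a x) fun _ => b x : Fin (M + 1) → Y → ℝ) i ∈ stdSimplex ℝ Y :=
    fun x => Fin.cases (ha x) fun _ => hb x
  refine majorizes_of_isSubunital
    (T := fun x => ⟨_, fun i => (hcons x i).1, fun i => (hcons x i).2⟩)
    (fun x y => ?_) fun x y => ?_
  · simpa [Fin.sum_univ_succ] using hab x y
  · simp only [hN x y, spikedUniform, Fin.sum_univ_succ, Fin.cons_zero, Fin.cons_succ,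
      Finset.sum_const, Finset.card_univ, Fintype.card_fin, nsmul_eq_mul]
    field_simp

theorem mul_logb_le_minExtension {X Y : Type} [Nonempty X] [Fintype Y] (N : ClassicalChannel X Y)
    {M : ℕ} (hM : 0 < M) {δ : ℝ} (h₀ : 0 < δ) (h₁ : δ < 1) {t : ℝ}
    (ht : ((M : ℝ) + 1) * t ≤ 1 - δ) (htail : ∀ x, tailMass (N.prob x) t ≤ δ) :
    (1 - δ) * Real.logb 2 M ≤ minExtension N :=
  (mul_logb_le_shannonEntropy_spikedUniform hM h₀.le h₁.le).trans <|
    (isLUB_minExtension N).1 ⟨_, _, spikedUniform_majorizes hM h₀ h₁ ht htail, rfl⟩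

end Flattening

section Concentration

/-- The expectation of `p(Y) ^ s` for a random outcome `Y` distributed according to `p`; in terms
of the Rényi entropy of order `1 + s` it is `2 ^ (-s * H_{1+s}(p))`. -/
noncomputable def selfMoment {Y : Type} [Fintype Y] (p : Y → ℝ) (s : ℝ) : ℝ :=
  ∑ y, p y * p y ^ s

theorem selfMoment_nonneg {Y : Type} [Fintype Y] {p : Y → ℝ} (hp : 0 ≤ p) (s : ℝ) :
    0 ≤ selfMoment p s :=
  Finset.sum_nonneg fun y _ => mul_nonneg (hp y) (Real.rpow_nonneg (hp y) s)

theorem tailMass_le {Y : Type} [Fintype Y] {p : Y → ℝ} (hp : 0 ≤ p) {t : ℝ} (ht : 0 < t) {s : ℝ}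
    (hs : 0 ≤ s) : tailMass p t ≤ t ^ (-s) * selfMoment p s := by
  classical
  rw [tailMass, selfMoment, Finset.mul_sum]
  refine (Finset.sum_le_sum fun y hy => ?_).trans
    (Finset.sum_le_sum_of_subset_of_nonneg (Finset.filter_subset _ _) fun y _ _ =>
      mul_nonneg (Real.rpow_nonneg ht.le _) (mul_nonneg (hp y) (Real.rpow_nonneg (hp y) s)))
  have hy' : t ^ s ≤ p y ^ s := Real.rpow_le_rpow ht.le (Finset.mem_filter.1 hy).2.le hs
  calc p y = t ^ (-s) * (p y * t ^ s) := by
        rw [mul_left_comm, ← Real.rpow_add ht, neg_add_cancel, Real.rpow_zero, mul_one]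
    _ ≤ t ^ (-s) * (p y * p y ^ s) := by gcongr; exact hp y

theorem selfMoment_power {X Y : Type} [Fintype Y] (N : ClassicalChannel X Y) (k : ℕ)
    (x : Fin k → X) (s : ℝ) :
    selfMoment ((N.power k).prob x) s = ∏ i, selfMoment (N.prob (x i)) s := by
  classical
  simp only [selfMoment]
  rw [Finset.prod_univ_sum, Fintype.piFinset_univ]
  refine Finset.sum_congr rfl fun y _ => ?_
  simp only [ClassicalChannel.power]
  rw [← Real.finsetProd_rpow _ _ fun i _ => N.nonneg _ _, Finset.prod_mul_distrib]

theorem hasDerivAt_selfMoment_zero {Y : Type} [Fintype Y] {p : Y → ℝ} (hp : 0 ≤ p) :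
    HasDerivAt (selfMoment p) (-(shannonEntropy p * Real.log 2)) 0 := by
  have hlog : Real.log 2 ≠ 0 := (Real.log_pos one_lt_two).ne'
  rw [shannonEntropy_eq_sum_negMulLog, div_mul_cancel₀ _ hlog, ← Finset.sum_neg_distrib]
  refine HasDerivAt.fun_sum fun y _ => ?_
  obtain h | h := (hp y).eq_or_lt
  · simpa [← h] using hasDerivAt_const (0 : ℝ) (0 : ℝ)
  · simpa [Real.negMulLog] using
      (Real.hasStrictDerivAt_const_rpow h 0).hasDerivAt.const_mul (p y)

theorem eventually_selfMoment_lt {Y : Type} [Fintype Y] {p : Y → ℝ} (hp : p ∈ stdSimplex ℝ Y)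
    {c : ℝ} (hc : c < shannonEntropy p) :
    ∀ᶠ s in 𝓝[>] (0 : ℝ), selfMoment p s < 2 ^ (-(s * c)) := by
  have hexp : HasDerivAt (fun s : ℝ => (2 : ℝ) ^ (-(s * c))) (-(c * Real.log 2)) 0 := by
    simpa [mul_comm] using ((hasDerivAt_id (0 : ℝ)).mul_const c).fun_neg.const_rpow (a := 2) two_pos
  have hneg : -(shannonEntropy p * Real.log 2) - -(c * Real.log 2) < 0 := by
    nlinarith [Real.log_pos one_lt_two]
  have hderiv := ((hasDerivAt_selfMoment_zero hp.1).sub hexp).hasDerivWithinAt (s := Set.Ioi 0)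
  filter_upwards [hderiv.limsup_slope_le' Set.self_notMem_Ioi hneg, self_mem_nhdsWithin]
    with s hs hs₀
  rw [slope_def_field, sub_zero, div_lt_iff₀ hs₀, zero_mul] at hs
  simpa [selfMoment, hp.2] using hs

end Concentration

section Regularization

variable {X Y : Type} [Fintype X] [Nonempty X] [Fintype Y]

theorem exists_forall_selfMoment_lt (N : ClassicalChannel X Y) {c : ℝ}
    (hc : c < minOutputEntropy X Y N) :
    ∃ s > 0, ∀ x, selfMoment (N.prob x) s < 2 ^ (-(s * c)) := by
  have hev : ∀ᶠ s in 𝓝[>] (0 : ℝ), ∀ x, selfMoment (N.prob x) s < 2 ^ (-(s * c)) :=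
    eventually_all.2 fun x => eventually_selfMoment_lt (N.prob_mem_stdSimplex x)
      (hc.trans_le (N.minOutputEntropy_le x))
  exact (eventually_mem_nhdsWithin.and hev).exists

theorem eventually_tailMass_power_le (N : ClassicalChannel X Y) {c : ℝ}
    (hc : c < minOutputEntropy X Y N) {C δ : ℝ} (hC : 0 < C) (hδ : 0 < δ) :
    ∀ᶠ k : ℕ in atTop, ∀ x, tailMass ((N.power k).prob x) (C * 2 ^ (-(k * c))) ≤ δ := by
  obtain ⟨c', hcc', hc'⟩ := exists_between hc
  obtain ⟨s, hs, hmoment⟩ := exists_forall_selfMoment_lt N hc'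
  have hlim : Tendsto (fun k : ℕ => C ^ (-s) * ((2 : ℝ) ^ (-(s * (c' - c)))) ^ k) atTop
      (𝓝 (C ^ (-s) * 0)) :=
    (tendsto_pow_atTop_nhds_zero_of_lt_one (by positivity)
      (Real.rpow_lt_one_of_one_lt_of_neg one_lt_two
        (neg_lt_zero.2 (mul_pos hs (sub_pos.2 hcc'))))).const_mul _
  rw [mul_zero] at hlim
  filter_upwards [hlim.eventually_le_const hδ] with k hk x
  have hprod : selfMoment ((N.power k).prob x) s ≤ ((2 : ℝ) ^ (-(s * c'))) ^ k := by
    rw [selfMoment_power]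
    exact (Finset.prod_le_prod (fun i _ => selfMoment_nonneg (N.nonneg (x i)) s)
      fun i _ => (hmoment (x i)).le).trans_eq (by simp)
  calc tailMass ((N.power k).prob x) (C * 2 ^ (-(k * c)))
      ≤ (C * 2 ^ (-(k * c))) ^ (-s) * selfMoment ((N.power k).prob x) s :=
        tailMass_le ((N.power k).nonneg x) (by positivity) hs.le
    _ ≤ (C * 2 ^ (-(k * c))) ^ (-s) * ((2 : ℝ) ^ (-(s * c'))) ^ k := by gcongr
    _ = C ^ (-s) * ((2 : ℝ) ^ (-(s * (c' - c)))) ^ k := by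
        rw [Real.mul_rpow hC.le (by positivity), mul_assoc, ← Real.rpow_mul two_pos.le,
          ← Real.rpow_mul_natCast two_pos.le, ← Real.rpow_mul_natCast two_pos.le,
          ← Real.rpow_add two_pos]
        ring_nf
    _ ≤ δ := hk

theorem eventually_mul_le_minExtension_power (N : ClassicalChannel X Y) {a : ℝ}
    (ha : a < minOutputEntropy X Y N) :
    ∀ᶠ k : ℕ in atTop, k * a ≤ minExtension (N.power k) := by
  obtain ha₀ | ha₀ := le_or_gt a 0
  · exact Eventually.of_forall fun k =>
      (mul_nonpos_of_nonneg_of_nonpos k.cast_nonneg ha₀).trans (minExtension_nonneg _)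
  obtain ⟨c, hac, hc⟩ := exists_between ha
  have hc₀ : 0 < c := ha₀.trans hac
  have hr₀ : 0 < a / c := div_pos ha₀ hc₀
  have hδ₀ : 0 < 1 - a / c := sub_pos.2 ((div_lt_one hc₀).2 hac)
  filter_upwards [eventually_tailMass_power_le N hc (C := a / c / 3) (by positivity) hδ₀]
    with k htail
  set L : ℝ := 2 ^ (k * c) with hL
  have hL₁ : 1 ≤ L := Real.one_le_rpow one_le_two (by positivity)
  have hM : 0 < ⌈L⌉₊ := Nat.ceil_pos.2 (by positivity)
  have hthreshold : ((⌈L⌉₊ : ℝ) + 1) * (a / c / 3 * 2 ^ (-(k * c))) ≤ 1 - (1 - a / c) := by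
    rw [Real.rpow_neg two_pos.le, ← hL, sub_sub_cancel]
    calc ((⌈L⌉₊ : ℝ) + 1) * (a / c / 3 * L⁻¹) ≤ (3 * L) * (a / c / 3 * L⁻¹) := by
          gcongr
          linarith [Nat.ceil_lt_add_one (zero_le_one.trans hL₁)]
      _ = a / c := by field_simp
  calc k * a = (1 - (1 - a / c)) * Real.logb 2 L := by
        rw [hL, Real.logb_rpow two_pos (by norm_num)]
        field_simp
        ring
    _ ≤ (1 - (1 - a / c)) * Real.logb 2 ⌈L⌉₊ := by
        gcongr
        · linarith
        · exact one_lt_two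
        · exact Nat.le_ceil L
    _ ≤ minExtension (N.power k) :=
        mul_logb_le_minExtension _ hM hδ₀ (sub_lt_self 1 hr₀) hthreshold htail

theorem minExtension_power_le (N : ClassicalChannel X Y) (k : ℕ) :
    minExtension (N.power k) ≤ k * minOutputEntropy X Y N := by
  obtain ⟨x, hx⟩ := (N.power k).exists_minOutputEntropy_eq
  rw [← isClassicalChannelEntropy_minOutputEntropy.power, hx]
  exact (isLUB_minExtension _).2 (shannonEntropy_mem_upperBounds_minExtensionSet _ x)

theorem tendsto_minExtension_power (N : ClassicalChannel X Y) :
    Tendsto (fun k : ℕ => (1 / (k : ℝ)) * minExtension (N.power k)) atTop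
      (𝓝 (minOutputEntropy X Y N)) := by
  refine tendsto_order.2 ⟨fun a ha => ?_, fun b hb => ?_⟩
  · obtain ⟨c, hac, hc⟩ := exists_between ha
    filter_upwards [eventually_mul_le_minExtension_power N hc, eventually_gt_atTop 0] with k h hk
    rw [one_div_mul_eq_div]
    exact hac.trans_le ((le_div_iff₀' (Nat.cast_pos.2 hk)).2 h)
  · filter_upwards [eventually_gt_atTop 0] with k hk
    rw [one_div_mul_eq_div]
    exact ((div_le_iff₀' (Nat.cast_pos.2 hk)).2 (minExtension_power_le N k)).trans_lt hb

namespace IsClassicalChannelEntropy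

variable {H : ClassicalChannelFunction}

theorem le_shannonEntropy (hH : IsClassicalChannelEntropy H)
    (hS : ∀ (Y : Type) [Fintype Y] (p : ClassicalChannel Unit Y),
      H Unit Y p = shannonEntropy (p.prob ())) (N : ClassicalChannel X Y) (x : X) :
    H X Y N ≤ shannonEntropy (N.prob x) := by
  rw [← hS Y ⟨fun _ => N.prob x, fun _ => N.nonneg x, fun _ => N.sum_eq_one x⟩]
  exact hH.monotone _ _ _ _ _ _
    (majorizes_of_equiv (fun _ => x) (Equiv.refl Y) fun _ _ => rfl)

theorem minExtension_le (hH : IsClassicalChannelEntropy H)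
    (hS : ∀ (Y : Type) [Fintype Y] (p : ClassicalChannel Unit Y),
      H Unit Y p = shannonEntropy (p.prob ())) (N : ClassicalChannel X Y) :
    minExtension N ≤ H X Y N := by
  refine (isLUB_minExtension N).2 ?_
  rintro h ⟨n, q, hq, rfl⟩
  rw [← hS]
  exact hH.monotone _ _ _ _ _ _ hq

theorem eq_minOutputEntropy (hH : IsClassicalChannelEntropy H)
    (hS : ∀ (Y : Type) [Fintype Y] (p : ClassicalChannel Unit Y),
      H Unit Y p = shannonEntropy (p.prob ())) (N : ClassicalChannel X Y) :
    H X Y N = minOutputEntropy X Y N := by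
  apply le_antisymm
  · obtain ⟨x, hx⟩ := N.exists_minOutputEntropy_eq
    exact hx ▸ hH.le_shannonEntropy hS N x
  · refine le_of_tendsto (tendsto_minExtension_power N) ?_
    filter_upwards [eventually_gt_atTop 0] with k hk
    rw [one_div_mul_eq_div, div_le_iff₀' (Nat.cast_pos.2 hk), ← hH.power]
    exact hH.minExtension_le hS (N.power k)

end IsClassicalChannelEntropy

end Regularization

theorem MarginallyUniform.of_forall {A₀ B C₁ : Type} [Fintype B] [DecidableEq B]
    {N : Matrix A₀ A₀ ℂ →ₗ[ℂ] Matrix (B × C₁) (B × C₁) ℂ} {K : Matrix A₀ A₀ ℂ → C₁ → C₁ → ℂ}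
    (h : ∀ ρ b c b' c', N ρ (b, c) (b', c') = if b = b' then K ρ c c' else 0) :
    MarginallyUniform N := by
  intro ρ b c b' c'
  obtain rfl | hb := eq_or_ne b b'
  · have hB : (Fintype.card B : ℂ) ≠ 0 := Nat.cast_ne_zero.2 (Fintype.card_pos_iff.2 ⟨b⟩).ne'
    simp [h, hB]
  · simp [h, hb]

theorem QuantumChannel.map_injective {A B : Type} [Fintype A] [Fintype B]
    {N M : QuantumChannel A B} (h : N.map = M.map) : N = M := by
  cases N
  cases M
  congr

open Classical in
/-- The isometry that sends each basis vector to the basis vector given by an embedding. -/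
noncomputable def embeddingMatrix {Y Y' : Type} (e : Y ↪ Y') : Matrix Y' Y ℂ :=
  (1 : Matrix Y' Y' ℂ).submatrix id e

theorem isIsometryMatrix_embeddingMatrix {Y Y' : Type} [Fintype Y'] (e : Y ↪ Y') :
    IsIsometryMatrix (embeddingMatrix e) := by
  classical
  rw [IsIsometryMatrix, embeddingMatrix, Matrix.conjTranspose_submatrix, Matrix.conjTranspose_one,
    ← Matrix.submatrix_mul _ _ e id e Function.bijective_id, one_mul,
    Matrix.submatrix_one_embedding]

theorem conjMap_embeddingMatrix_diagonal {Y Y' : Type} [Fintype Y] [DecidableEq Y] [DecidableEq Y']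
    (e : Y ↪ Y') (v : Y → ℂ) : conjMap (embeddingMatrix e) (Matrix.diagonal v) =
      Matrix.diagonal fun y' => ∑ y, if e y = y' then v y else 0 := by
  ext i j
  simp only [conjMap, LinearMap.coe_mk, AddHom.coe_mk, Matrix.mul_apply,
    embeddingMatrix, Matrix.conjTranspose_apply, Matrix.submatrix_apply, Matrix.one_apply,
    Matrix.diagonal_apply, id]
  obtain rfl | hij := eq_or_ne i j
  · rw [if_pos rfl]
    refine Finset.sum_congr rfl fun y _ => ?_
    by_cases hy : i = e y <;> simp [hy, eq_comm]
  · rw [if_neg hij]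
    refine Finset.sum_eq_zero fun y _ => ?_
    by_cases hy : i = e y
    · simp [← hy, hij.symm]
    · simp [hy]

theorem ofReal_sqrt_mul_self {a : ℝ} (ha : 0 ≤ a) :
    (Real.sqrt a : ℂ) * (Real.sqrt a : ℂ) = a := by
  rw [← Complex.ofReal_mul, Real.mul_self_sqrt ha]

namespace ClassicalChannel

variable {X Y X' Y' Z : Type} [Fintype X] [Fintype Y] [Fintype X'] [Fintype Y'] [Fintype Z]

theorem toLinearMap_apply [DecidableEq Y] (N : ClassicalChannel X Y) (ρ : Matrix X X ℂ)
    (y y' : Y) :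
    N.toLinearMap ρ y y' = if y = y' then ∑ x, ρ x x * (N.prob x y : ℂ) else 0 := by
  simp [toLinearMap, Matrix.diagonal_apply]

theorem toQuantum_tensor (N : ClassicalChannel X Y) (M : ClassicalChannel X' Y') :
    (N.tensor M).toQuantum = N.toQuantum.tensor M.toQuantum := by
  classical
  refine QuantumChannel.map_injective (LinearMap.ext fun ρ => Matrix.ext fun i j => ?_)
  change (N.tensor M).toLinearMap ρ i j =
    N.toLinearMap (Matrix.of fun x x' => M.toLinearMap
      (Matrix.of fun a a' => ρ (x, a) (x', a')) i.2 j.2) i.1 j.1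
  simp only [toLinearMap_apply, Matrix.of_apply, Fintype.sum_prod_type, tensor, Prod.ext_iff,
    ite_and, ite_mul, zero_mul, Finset.sum_mul, Complex.ofReal_mul]
  split_ifs <;> simp [mul_left_comm, mul_comm]

theorem conjMap_embeddingMatrix_comp_toLinearMap (N : ClassicalChannel X Y) (e : Y ↪ Y') :
    conjMap (embeddingMatrix e) ∘ₗ N.toLinearMap = (N.embed e).toLinearMap := by
  classical
  refine LinearMap.ext fun ρ => (conjMap_embeddingMatrix_diagonal e _).trans ?_
  refine congrArg Matrix.diagonal (funext fun y' => ?_)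
  simp only [embed, Complex.ofReal_sum, Finset.mul_sum, apply_ite Complex.ofReal, mul_ite,
    Complex.ofReal_zero, mul_zero]
  rw [Finset.sum_comm]
  refine Finset.sum_congr rfl fun y _ => ?_
  split_ifs <;> simp

open Classical in
/-- The isometry `|w⟩ ↦ ∑ x z, √(S(x, z | w)) |w, z, x⟩`, a coherent version of `S` whose reference
system keeps the input `w` and the message `z`. The copy of `w` makes it an isometry. -/
noncomputable def dilation (S : ClassicalChannel X' (X × Z)) : Matrix ((X' × Z) × X) X' ℂ :=
  Matrix.of fun i => Pi.single i.1.1 (Real.sqrt (S.prob i.1.1 (i.2, i.1.2)) : ℂ)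

theorem isIsometryMatrix_dilation (S : ClassicalChannel X' (X × Z)) :
    IsIsometryMatrix S.dilation := by
  classical
  ext w w'
  have hsum : ∑ x, ∑ z, (S.prob w (x, z) : ℂ) = 1 := by
    exact_mod_cast (Fintype.sum_prod_type _).symm.trans (S.sum_eq_one w)
  rw [Finset.sum_comm] at hsum
  simp only [Matrix.mul_apply, Matrix.conjTranspose_apply, dilation, Matrix.of_apply,
    Fintype.sum_prod_type, Pi.single_apply]
  obtain rfl | hw := eq_or_ne w w'
  · simp [ofReal_sqrt_mul_self (S.nonneg _ _), hsum]
  · simp [hw]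

theorem conjMap_dilation_apply_self (S : ClassicalChannel X' (X × Z)) (ρ : Matrix X' X' ℂ)
    (w : X') (z : Z) (x : X) :
    conjMap S.dilation ρ ((w, z), x) ((w, z), x) = S.prob w (x, z) * ρ w w := by
  classical
  simp only [conjMap, LinearMap.coe_mk, AddHom.coe_mk, Matrix.mul_apply, dilation,
    Matrix.conjTranspose_apply, Matrix.of_apply, Pi.single_apply]
  rw [← ofReal_sqrt_mul_self (S.nonneg w (x, z)), Finset.sum_eq_single w (by simp +contextual)
    (by simp)]
  simp [mul_right_comm]

/-- The classical channel that applies to its input in `Y` a doubly stochastic matrix chosen by a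
message in `R`; it is the post-processing of a mixing superchannel. -/
def controlled {R : Type} [DecidableEq Y] (D : R → Matrix Y Y ℝ)
    (hD : ∀ r, D r ∈ doublyStochastic ℝ Y) : ClassicalChannel (R × Y) Y where
  prob i y := D i.1 y i.2
  nonneg _ _ := nonneg_of_mem_doublyStochastic (hD _)
  sum_eq_one _ := sum_col_of_mem_doublyStochastic (hD _) _

section controlled

variable {A A' B : Type} [Fintype A] [Fintype A'] [Fintype B] [DecidableEq B]
  {Θ : Superchannel A B A'} {D : Θ.R → Matrix B B ℝ} {hD : ∀ r, D r ∈ doublyStochastic ℝ B}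

theorem exists_applyExt_eq_of_controlled (hE : Θ.E.map = (controlled D hD).toLinearMap)
    {C₀ C₁ : Type} (N : Matrix (A × C₀) (A × C₀) ℂ →ₗ[ℂ] Matrix (B × C₁) (B × C₁) ℂ)
    (ρ : Matrix (A' × C₀) (A' × C₀) ℂ) :
    ∃ σ : Θ.R → Matrix (A × C₀) (A × C₀) ℂ, ∀ b c b' c',
      Θ.applyExt N ρ (b, c) (b', c') =
        if b = b' then ∑ r, ∑ d, N (σ r) (d, c) (d, c') * (D r b d : ℂ) else 0 := by
  refine ⟨fun r => Matrix.of fun a a' => Matrix.reindexLinearEquiv ℂ ℂ (Equiv.prodAssoc Θ.R A C₀)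
    (Equiv.prodAssoc Θ.R A C₀) (tensorId C₀ (conjMap Θ.V) ρ) (r, a) (r, a'), fun b c b' c' => ?_⟩
  change Θ.E.map (Matrix.of fun i j => N _ (i.2, c) (j.2, c')) b b' = _
  rw [hE, toLinearMap_apply]
  simp only [Fintype.sum_prod_type]
  rfl

theorem isMixing_of_controlled (hE : Θ.E.map = (controlled D hD).toLinearMap) : Θ.IsMixing := by
  intro C₀ C₁ _ _ _ _ N hN
  choose σ hσ using exists_applyExt_eq_of_controlled hE N.map
  have hrow : ∀ r b, ∑ d, (D r b d : ℂ) = 1 := fun r b => by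
    exact_mod_cast sum_row_of_mem_doublyStochastic (hD r) b
  have hflat : ∀ τ d c c', N.map τ (d, c) (d, c') =
      (Fintype.card B : ℂ)⁻¹ * ∑ d', N.map τ (d', c) (d', c') := fun τ d c c' =>
    (hN τ d c d c').trans (if_pos rfl)
  refine MarginallyUniform.of_forall (K := fun ρ c c' =>
    ∑ r, (Fintype.card B : ℂ)⁻¹ * ∑ d', N.map (σ ρ r) (d', c) (d', c')) fun ρ b c b' c' => ?_
  rw [hσ]
  refine if_congr Iff.rfl (Finset.sum_congr rfl fun r _ => ?_) rfl
  rw [Finset.sum_congr rfl fun d _ => by rw [hflat _ d], ← Finset.mul_sum, hrow, mul_one]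

end controlled

theorem MajorizesSame.toLinearMap {N : ClassicalChannel X Y} {M : ClassicalChannel X' Y}
    (h : N.MajorizesSame M) : QuantumMajorizesSame N.toLinearMap M.toLinearMap := by
  classical
  obtain ⟨Z, _, S, D, hD, hM⟩ := h
  let E : ClassicalChannel ((X' × Z) × Y) Y := controlled (fun r => D r.2) fun r => hD r.2
  refine ⟨⟨X' × Z, S.dilation, S.isIsometryMatrix_dilation, E.toQuantum⟩,
    isMixing_of_controlled (D := fun r : X' × Z => D r.2) (hD := fun r => hD r.2) rfl,
    LinearMap.ext fun ρ => Matrix.ext fun y y' => ?_⟩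
  change _ = E.toLinearMap (Matrix.of fun i j => N.toLinearMap
      (Matrix.of fun x x' => conjMap S.dilation ρ (i.1, x) (j.1, x')) i.2 j.2) y y'
  simp only [toLinearMap_apply, Matrix.of_apply, Fintype.sum_prod_type,
    conjMap_dilation_apply_self, if_true, hM]
  refine if_congr Iff.rfl (Finset.sum_congr rfl fun w _ => ?_) rfl
  simp only [E, controlled, Matrix.mulVec, dotProduct, Complex.ofReal_sum, Complex.ofReal_mul,
    Finset.mul_sum, Finset.sum_mul]
  rw [Finset.sum_comm]
  refine Finset.sum_congr rfl fun z _ => ?_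
  rw [Finset.sum_comm]
  exact Finset.sum_congr rfl fun d _ => Finset.sum_congr rfl fun x _ => by ring

theorem Majorizes.toQuantum {N : ClassicalChannel X Y} {M : ClassicalChannel X' Y'}
    (h : N.Majorizes M) : N.toQuantum.Majorizes M.toQuantum := by
  obtain ⟨hc, e, h⟩ | ⟨hc, e, h⟩ := h
  · refine Or.inl ⟨hc, embeddingMatrix e, isIsometryMatrix_embeddingMatrix e, ?_⟩
    exact (M.conjMap_embeddingMatrix_comp_toLinearMap e).symm ▸ h.toLinearMap
  · refine Or.inr ⟨hc, embeddingMatrix e, isIsometryMatrix_embeddingMatrix e, ?_⟩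
    exact (N.conjMap_embeddingMatrix_comp_toLinearMap e).symm ▸ h.toLinearMap

end ClassicalChannel

theorem IsChannelEntropy.isClassicalChannelEntropy {H : QuantumChannelFunction}
    (hH : IsChannelEntropy H)
    (hS : ∀ (Y : Type) [Fintype Y] (p : ClassicalChannel Unit Y),
      H Unit Y p.toQuantum = shannonEntropy (p.prob ())) :
    IsClassicalChannelEntropy fun X Y _ _ _ N => H X Y N.toQuantum where
  nonzero := by
    obtain ⟨p, hp⟩ := exists_shannonEntropy_ne_zero
    exact ⟨Unit, Bool, inferInstance, inferInstance, inferInstance, p, by rwa [hS]⟩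
  monotone X Y X' Y' _ _ _ _ _ _ N M h := hH.monotone _ _ _ _ _ _ h.toQuantum
  additive X Y X' Y' _ _ _ _ _ _ N M := by
    rw [toQuantum_tensor, hH.additive]

theorem theorem20 :
    -- The extensions are genuine suprema and infima, and both the regularized minimal
    -- extension (the limit exists) and the maximal extension equal `min_x H(p_x)`.
    (∀ (X Y : Type) [Fintype X] [Nonempty X] [Fintype Y] (N : ClassicalChannel X Y),
      IsLUB (minExtensionSet N) (minExtension N) ∧
      IsGLB (maxExtensionSet N) (maxExtension N) ∧
      Tendsto (fun k : ℕ => (1 / (k : ℝ)) * minExtension (N.power k)) atTop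
        (𝓝 (minOutputEntropy X Y N)) ∧
      maxExtension N = minOutputEntropy X Y N) ∧
    -- Every channel entropy that reduces to Shannon entropy takes this value on every
    -- classical channel.
    (∀ H : QuantumChannelFunction, IsChannelEntropy H →
      (∀ (Y : Type) [Fintype Y] (p : ClassicalChannel Unit Y),
        H Unit Y p.toQuantum = shannonEntropy (p.prob ())) →
      ∀ (X Y : Type) [Fintype X] [Nonempty X] [Fintype Y] (N : ClassicalChannel X Y),
        H X Y N.toQuantum = minOutputEntropy X Y N) ∧
    -- On the classical domain there is exactly one such entropy.
    (∀ H : ClassicalChannelFunction,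
      (IsClassicalChannelEntropy H ∧
        ∀ (Y : Type) [Fintype Y] (p : ClassicalChannel Unit Y),
          H Unit Y p = shannonEntropy (p.prob ())) ↔
      ∀ (X Y : Type) [Fintype X] [Nonempty X] [Fintype Y] (N : ClassicalChannel X Y),
        H X Y N = minOutputEntropy X Y N) := by
  refine ⟨fun X Y _ _ _ N => ⟨isLUB_minExtension N, ?_, tendsto_minExtension_power N,
    maxExtension_eq_minOutputEntropy N⟩, fun H hH hS X Y _ _ _ N => ?_,
    fun H => ⟨fun ⟨hH, hS⟩ X Y _ _ _ N => hH.eq_minOutputEntropy hS N, fun h => ?_⟩⟩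
  · rw [maxExtension_eq_minOutputEntropy]
    exact (isLeast_maxExtensionSet N).isGLB
  · exact (hH.isClassicalChannelEntropy hS).eq_minOutputEntropy hS N
  · obtain rfl : H = minOutputEntropy := by
      funext X Y _ _ _ N
      exact h X Y N
    exact ⟨isClassicalChannelEntropy_minOutputEntropy, fun Y _ p => minOutputEntropy_unit p⟩
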